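/- There is an absolute constant $K>0$ such that the following holds for all integers $n\ge 2$ and $d\ge 1$. Let $|\psi\rangle=\sum_{x\in\{0,1\}^n}\psi_x|x\rangle$ be an $n$-qubit $d$-sparse quantum state, i.e. $\sum_x|\psi_x|^2=1$ and at most $d$ of the amplitudes $\psi_x\in\mathbb{C}$ are non-zero. Then there is a quantum circuit acting on exactly these $n$ qubits (without ancillary qubits), whose gates are arbitrary single-qubit unitaries and CNOT gates between arbitrary pairs of qubits, whose unitary $U$ satisfies $U|0\rangle^{\otimes n}=|\psi\rangle$ exactly, and whose size (total number of gates) is at most $$K\left(\frac{nd}{\log_2 n}+n\right).$$ -/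

import Mathlib

open scoped Matrix

namespace SparsePrep

/-- Computational basis states of `n` qubits: bit strings of length `n`. -/
abbrev Bits (n : ℕ) : Type := Fin n → Fin 2

/-- Elementary gates on `n` qubits: an arbitrary single-qubit unitary `U` on qubit `i`, or a
CNOT with control qubit `c` and (different) target qubit `t`. -/
inductive Gate (n : ℕ) : Type where
  | single (i : Fin n) (U : Matrix.unitaryGroup (Fin 2) ℂ) : Gate n
  | cnot (c t : Fin n) (hct : c ≠ t) : Gate n

/-- The unitary operator of a gate in the computational basis: the entry in row `x` and
column `y` is `⟨x| G |y⟩`. -/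
def Gate.toMatrix {n : ℕ} : Gate n → Matrix (Bits n) (Bits n) ℂ
  | .single i U => Matrix.of fun x y =>
      if ∀ j, j ≠ i → x j = y j then (U : Matrix (Fin 2) (Fin 2) ℂ) (x i) (y i) else 0
  | .cnot c t _ => Matrix.of fun x y =>
      if x = Function.update y t (y t + y c) then 1 else 0

/-- A quantum circuit on `n` qubits: the list of its gates, in the order of application. -/
abbrev Circuit (n : ℕ) : Type := List (Gate n)

/-- The size of a circuit: its total number of elementary gates. -/
def Circuit.size {n : ℕ} (C : Circuit n) : ℕ := List.length C

/-- The unitary operator of a circuit: the head of the list is applied first. -/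
def Circuit.toMatrix {n : ℕ} : Circuit n → Matrix (Bits n) (Bits n) ℂ
  | [] => 1
  | g :: C => Circuit.toMatrix C * g.toMatrix

/-- The basis vector `|x⟩`. -/
def ket {n : ℕ} (x : Bits n) : Bits n → ℂ := Pi.single x 1

/-- `ψ` (given by its amplitudes) is an `n`-qubit `d`-sparse quantum state: it is a unit vector
with at most `d` non-zero amplitudes. -/
structure IsSparseState {n : ℕ} (d : ℕ) (ψ : Bits n → ℂ) : Prop where
  normalized : ∑ x, ‖ψ x‖ ^ 2 = 1
  sparse : (Function.support ψ).ncard ≤ d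

/-- The circuit `C`, acting on exactly the `n` qubits of the state (no ancillary qubits),
maps `|0…0⟩` exactly to `ψ`. -/
def Circuit.Prepares {n : ℕ} (C : Circuit n) (ψ : Bits n → ℂ) : Prop :=
  Circuit.toMatrix C *ᵥ ket 0 = ψ

end SparsePrep

/-! Circuits are invertible, so it suffices to disentangle `ψ` into a multiple of a basis state.
Each round picks about `(log₂ n) / 2` support strings and merges their amplitudes into one with
`O(n)` gates, so about `d / log n` rounds suffice (`exists_reduction`).

A round first compresses the `m` chosen strings to at most `m` qubits by CNOTs
(`exists_compression`). On those qubits they have at most `2 ^ m` distinct columns, so copying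
clears the duplicates and Gaussian elimination finishes. A Householder reflection then merges the
amplitudes (`exists_merge`); it is a sign flip at `|0⟩` conjugated by a circuit of size `O(2 ^ m)`
that disentangles the reflection vector (`exists_disentangler`).

The obstacle is the sign flip without ancillas. The version in `exists_signFlip` ignores one qubit
`f`, hence also flips the sign of `|0⟩` with `f` set. This does no harm if the state vanishes on the
copies of the chosen strings with `f` flipped. A counting argument supplies a shift `v` off the
support, and CNOTs turn `v` into a flip of `f`. When the support is too large for the counting, `2 ^
n` is itself within the bound, up to a constant, and a generic disentangler is used. -/

namespace SparsePrep

open Function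

variable {n : ℕ}

/-! ### Action of circuits on amplitudes, and inverse circuits -/

/-- The action of a circuit on a vector of amplitudes. -/
def act {n : ℕ} (C : Circuit n) (ψ : Bits n → ℂ) : Bits n → ℂ := Circuit.toMatrix C *ᵥ ψ

@[simp] theorem act_nil (ψ : Bits n → ℂ) : act [] ψ = ψ := by
  simp [act, Circuit.toMatrix]

theorem act_cons (g : Gate n) (C : Circuit n) (ψ : Bits n → ℂ) :
    act (g :: C) ψ = act C (g.toMatrix *ᵥ ψ) := by
  simp [act, Circuit.toMatrix, Matrix.mulVec_mulVec]

theorem act_append (C D : Circuit n) (ψ : Bits n → ℂ) : act (C ++ D) ψ = act D (act C ψ) := by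
  induction C generalizing ψ with
  | nil => simp
  | cons g C ih => simp [act_cons, ih]

theorem single_mulVec (i : Fin n) (U : Matrix.unitaryGroup (Fin 2) ℂ) (ψ : Bits n → ℂ)
    (x : Bits n) : ((Gate.single i U).toMatrix *ᵥ ψ) x =
      ∑ b, (U : Matrix (Fin 2) (Fin 2) ℂ) (x i) b * ψ (update x i b) := by
  symm
  simp only [Matrix.mulVec, dotProduct]
  apply Fintype.sum_of_injective (fun b => update x i b) (update_injective x i)
  · intro y hy
    rw [Gate.toMatrix, Matrix.of_apply, if_neg, zero_mul]
    intro h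
    apply hy
    refine ⟨y i, ?_⟩
    ext j
    by_cases hj : j = i
    · subst hj; simp
    · simp [hj, h j hj]
  · intro b
    rw [Gate.toMatrix, Matrix.of_apply, if_pos]
    · simp
    · intro j hj; simp [hj]

theorem update_add_involutive (c t : Fin n) (hct : c ≠ t) :
    Involutive (fun x : Bits n => update x t (x t + x c)) := by
  intro x
  have h : ∀ a b : Fin 2, a + b + b = a := by decide
  simp [hct, h]

theorem cnot_mulVec (c t : Fin n) (hct : c ≠ t) (ψ : Bits n → ℂ) (x : Bits n) :
    ((Gate.cnot c t hct).toMatrix *ᵥ ψ) x = ψ (update x t (x t + x c)) := by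
  have h := update_add_involutive c t hct
  simp only [Matrix.mulVec, dotProduct, Gate.toMatrix, Matrix.of_apply]
  rw [Finset.sum_eq_single (update x t (x t + x c))]
  · rw [if_pos (h x).symm, one_mul]
  · intro y _ hy
    rw [if_neg, zero_mul]
    rintro rfl
    exact hy (h y).symm
  · simp

/-- The inverse gate. -/
def Gate.inv : Gate n → Gate n
  | .single i U => .single i U⁻¹
  | .cnot c t h => .cnot c t h

theorem Gate.inv_toMatrix (g : Gate n) : g.inv.toMatrix = g.toMatrixᴴ := by
  cases g with
  | single i U =>
    ext x y
    simp only [Gate.inv, Gate.toMatrix, Matrix.of_apply, Matrix.conjTranspose_apply]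
    by_cases h : ∀ j, j ≠ i → x j = y j
    · rw [if_pos h, if_pos (fun j hj => (h j hj).symm)]
      rfl
    · rw [if_neg h, if_neg (fun h' => h fun j hj => (h' j hj).symm), star_zero]
  | cnot c t h =>
    ext x y
    have hi := update_add_involutive c t h
    simp only [Gate.inv, Gate.toMatrix, Matrix.of_apply, Matrix.conjTranspose_apply]
    have : x = update y t (y t + y c) ↔ y = update x t (x t + x c) :=
      ⟨fun e => by rw [e]; exact (hi y).symm, fun e => by rw [e]; exact (hi x).symm⟩
    simp [this, apply_ite]

theorem Gate.inv_mul (g : Gate n) : g.inv.toMatrix * g.toMatrix = 1 := by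
  apply Matrix.mulVec_injective
  ext ψ x
  rw [← Matrix.mulVec_mulVec, Matrix.one_mulVec]
  cases g with
  | single i U =>
    simp only [Gate.inv, single_mulVec, update_self, update_idem]
    have h : ∀ a c, ∑ b, (U⁻¹ : Matrix.unitaryGroup (Fin 2) ℂ).1 a b * U.1 b c
        = if a = c then 1 else 0 := by
      intro a c
      have := congrFun (congrFun (congrArg Subtype.val (inv_mul_cancel U)) a) c
      rwa [Submonoid.coe_mul, Matrix.mul_apply, Submonoid.coe_one, Matrix.one_apply] at this
    simp only [Finset.mul_sum, ← mul_assoc]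
    rw [Finset.sum_comm]
    simp only [← Finset.sum_mul, h]
    simp
  | cnot c t h =>
    simp only [Gate.inv, cnot_mulVec]
    exact congrArg ψ (update_add_involutive c t h x)

/-- The inverse circuit. -/
def inv (C : Circuit n) : Circuit n := (C.map Gate.inv).reverse

@[simp] theorem length_inv (C : Circuit n) : (inv C).length = C.length := by simp [inv]

theorem toMatrix_append (C D : Circuit n) :
    Circuit.toMatrix (C ++ D) = Circuit.toMatrix D * Circuit.toMatrix C := by
  apply Matrix.mulVec_injective
  ext1 ψ
  rw [← Matrix.mulVec_mulVec]
  exact act_append C D ψ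

theorem toMatrix_inv (C : Circuit n) :
    Circuit.toMatrix (inv C) = (Circuit.toMatrix C)ᴴ := by
  induction C with
  | nil => simp [inv, Circuit.toMatrix]
  | cons g C ih =>
    have : inv (g :: C) = inv C ++ [g.inv] := by simp [inv]
    rw [this, toMatrix_append, ih]
    simp [Circuit.toMatrix, Gate.inv_toMatrix]

theorem toMatrix_inv_mul (C : Circuit n) :
    Circuit.toMatrix (inv C) * Circuit.toMatrix C = 1 := by
  induction C with
  | nil => simp [inv, Circuit.toMatrix]
  | cons g C ih =>
    have : inv (g :: C) = inv C ++ [g.inv] := by simp [inv]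
    rw [this, toMatrix_append]
    simp only [Circuit.toMatrix, one_mul]
    rw [Matrix.mul_assoc, ← Matrix.mul_assoc (Circuit.toMatrix (inv C)), ih, Matrix.one_mul,
      Gate.inv_mul]

@[simp] theorem act_inv_act (C : Circuit n) (ψ : Bits n → ℂ) : act (inv C) (act C ψ) = ψ := by
  simp [act, Matrix.mulVec_mulVec, toMatrix_inv_mul]

@[simp] theorem act_act_inv (C : Circuit n) (ψ : Bits n → ℂ) : act C (act (inv C) ψ) = ψ := by
  simp [act, Matrix.mulVec_mulVec, mul_eq_one_comm.mp (toMatrix_inv_mul C)]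

theorem star_act_dotProduct_act (C : Circuit n) (φ ψ : Bits n → ℂ) :
    star (act C φ) ⬝ᵥ act C ψ = star φ ⬝ᵥ ψ := by
  simp only [act]
  rw [Matrix.star_mulVec, ← Matrix.dotProduct_mulVec, Matrix.mulVec_mulVec, ← toMatrix_inv,
    toMatrix_inv_mul, Matrix.one_mulVec]

theorem act_sub (C : Circuit n) (φ ψ : Bits n → ℂ) : act C (φ - ψ) = act C φ - act C ψ :=
  Matrix.mulVec_sub _ _ _

theorem act_smul (C : Circuit n) (c : ℂ) (ψ : Bits n → ℂ) : act C (c • ψ) = c • act C ψ :=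
  Matrix.mulVec_smul _ _ _

/-! ### Multiplexed rotations and disentangling -/

/-- A one-parameter group of single-qubit rotations that is inverted by conjugation with the
bit flip. -/
structure IsRotation (R : ℝ → Matrix.unitaryGroup (Fin 2) ℂ) : Prop where
  add : ∀ a b, R (a + b) = R a * R b
  flip : ∀ a i j, (R (-a)).1 i j = (R a).1 (i + 1) (j + 1)

/-- `f` depends only on the qubits in `Q`. -/
def DependsOnly {α : Type*} (f : Bits n → α) (Q : Finset (Fin n)) : Prop :=
  ∀ x y, (∀ i ∈ Q, x i = y i) → f x = f y

theorem DependsOnly.update {α : Type*} {f : Bits n → α} {Q : Finset (Fin n)}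
    (hf : DependsOnly f Q) {t : Fin n} (ht : t ∉ Q) (x : Bits n) (b : Fin 2) :
    f (update x t b) = f x :=
  hf _ _ fun i hi => by rw [update_of_ne]; rintro rfl; exact ht hi

/-- Half-sum and half-difference of the two angles for `q = 0, 1` reduce to one control fewer:
conjugation by the CNOT negates the half-difference exactly when `q = 1`. The `+ 2` makes the bound
additive under the recursion `L ↦ 2 L + 2`. -/
theorem exists_multiplexer {R : ℝ → Matrix.unitaryGroup (Fin 2) ℂ} (hR : IsRotation R)
    (t : Fin n) (Q : Finset (Fin n)) (ht : t ∉ Q) (θ : Bits n → ℝ) (hθ : DependsOnly θ Q) :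
    ∃ C : Circuit n, C.length + 2 ≤ 3 * 2 ^ Q.card ∧ ∀ ψ x,
      act C ψ x = ∑ b, (R (θ x)).1 (x t) b * ψ (update x t b) := by
  induction Q using Finset.induction_on generalizing θ with
  | empty =>
    refine ⟨[.single t (R (θ 0))], by simp, fun ψ x => ?_⟩
    rw [act_cons, act_nil, single_mulVec, hθ x 0 (by simp)]
  | insert q Q hq ih =>
    have htq : q ≠ t := fun h => ht (by simp [h])
    have htQ : t ∉ Q := fun h => ht (by simp [h])
    have key : ∀ b, DependsOnly (fun x => θ (update x q b)) Q := by
      intro b x y h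
      apply hθ
      intro i hi
      by_cases hiq : i = q
      · subst hiq; simp
      · rw [update_of_ne hiq, update_of_ne hiq]
        exact h i (Finset.mem_of_mem_insert_of_ne hi hiq)
    have hα : DependsOnly (fun x => (θ (update x q 0) + θ (update x q 1)) / 2) Q := by
      intro x y h
      simp only [key 0 x y h, key 1 x y h]
    have hβ : DependsOnly (fun x => (θ (update x q 0) - θ (update x q 1)) / 2) Q := by
      intro x y h
      simp only [key 0 x y h, key 1 x y h]
    obtain ⟨A, hA, hA'⟩ := ih htQ _ hα
    obtain ⟨B, hB, hB'⟩ := ih htQ _ hβ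
    refine ⟨.cnot q t htq :: (B ++ .cnot q t htq :: A), ?_, fun ψ x => ?_⟩
    · simp only [List.length_cons, List.length_append, Finset.card_insert_of_notMem hq, pow_succ]
      omega
    · rw [act_cons, act_append, act_cons, hA']
      simp only [cnot_mulVec, hB', update_self, update_idem, update_of_ne htq]
      have hβ' := fun x b => hβ.update htQ x b
      beta_reduce at hβ'
      simp only [hβ']
      have hx : ∀ b, x q = b → update x q b = x := by rintro b rfl; simp
      obtain h0 | h1 : x q = 0 ∨ x q = 1 := by
        generalize x q = b; revert b; decide
      · have : θ x = (θ (update x q 0) + θ (update x q 1)) / 2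
            + (θ (update x q 0) - θ (update x q 1)) / 2 := by
          rw [hx 0 h0]; ring
        rw [this, hR.add]
        simp only [Fin.sum_univ_two, h0]
        simp only [Submonoid.coe_mul, Matrix.mul_apply, Fin.sum_univ_two, add_zero]
        ring
      · have : θ x = (θ (update x q 0) + θ (update x q 1)) / 2
            + -((θ (update x q 0) - θ (update x q 1)) / 2) := by
          rw [hx 1 h1]; ring
        rw [this, hR.add]
        have h11 : (1 : Fin 2) + 1 = 0 := rfl
        simp only [Fin.sum_univ_two, h1, Submonoid.coe_mul, Matrix.mul_apply, hR.flip, h11, zero_add]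
        ring

theorem mem_unitaryGroup_two {a b c d : ℂ} (h1 : a * star a + b * star b = 1)
    (h2 : a * star c + b * star d = 0) (h3 : c * star c + d * star d = 1) :
    !![a, b; c, d] ∈ Matrix.unitaryGroup (Fin 2) ℂ := by
  have h4 : c * star a + d * star b = 0 := by
    have := congrArg star h2
    simpa [mul_comm] using this
  rw [Matrix.mem_unitaryGroup_iff, Matrix.star_eq_conjTranspose]
  ext i j
  fin_cases i <;> fin_cases j <;> simp [Matrix.mul_apply, Fin.sum_univ_two] <;> assumption

/-- Rotation about the `y` axis. -/
noncomputable def rotY (θ : ℝ) : Matrix.unitaryGroup (Fin 2) ℂ :=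
  ⟨!![(Real.cos θ : ℂ), -(Real.sin θ : ℂ); (Real.sin θ : ℂ), (Real.cos θ : ℂ)], by
    have h := Complex.sin_sq_add_cos_sq θ
    apply mem_unitaryGroup_two <;>
      simp only [RCLike.star_def, map_neg, Complex.conj_ofReal, Complex.ofReal_cos,
        Complex.ofReal_sin, ← Complex.cos_conj, ← Complex.sin_conj]
    · linear_combination h
    · ring
    · linear_combination h⟩

/-- Rotation about the `z` axis. -/
noncomputable def rotZ (φ : ℝ) : Matrix.unitaryGroup (Fin 2) ℂ :=
  ⟨!![Complex.exp (-φ * Complex.I), 0; 0, Complex.exp (φ * Complex.I)], by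
    apply mem_unitaryGroup_two <;>
      simp [← Complex.exp_conj, ← Complex.exp_add]⟩

theorem isRotation_rotY : IsRotation rotY where
  add a b := by
    ext i j
    fin_cases i <;> fin_cases j <;>
      simp [rotY, Complex.cos_add, Complex.sin_add] <;> ring
  flip a i j := by
    fin_cases i <;> fin_cases j <;> simp [rotY]

theorem isRotation_rotZ : IsRotation rotZ where
  add a b := by
    ext i j
    fin_cases i <;> fin_cases j <;>
      simp [rotZ, ← Complex.exp_add] <;> ring_nf
  flip a i j := by
    fin_cases i <;> fin_cases j <;> simp [rotZ]

/-- Two rotations disentangle any pair of amplitudes. -/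
theorem exists_angles (a b : ℂ) : ∃ φ θ : ℝ,
    (rotY θ).1 1 0 * ((rotZ φ).1 0 0 * a) + (rotY θ).1 1 1 * ((rotZ φ).1 1 1 * b) = 0 := by
  have key : ∀ z : ℂ, ∀ s t : ℝ, s + t = Complex.arg z →
      Complex.exp (-s * Complex.I) * z = ‖z‖ * Complex.exp (t * Complex.I) := by
    intro z s t h
    conv_lhs => rw [← Complex.norm_mul_exp_arg_mul_I z]
    rw [mul_left_comm, ← Complex.exp_add, ← h]
    push_cast
    ring_nf
  -- The `z` rotation gives both amplitudes the mean phase; the `y` rotation then turns the real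
  -- vector `(‖a‖, ‖b‖)` onto the first axis.
  refine ⟨(a.arg - b.arg) / 2, -Complex.arg (‖a‖ + ‖b‖ * Complex.I), ?_⟩
  set z : ℂ := ‖a‖ + ‖b‖ * Complex.I with hz
  have ha := key a ((a.arg - b.arg) / 2) ((a.arg + b.arg) / 2) (by ring)
  have hb := key b (-((a.arg - b.arg) / 2)) ((a.arg + b.arg) / 2) (by ring)
  have hre : ‖z‖ * Real.cos z.arg = ‖a‖ := by
    rw [Complex.norm_mul_cos_arg]; simp [hz]
  have him : ‖z‖ * Real.sin z.arg = ‖b‖ := by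
    rw [Complex.norm_mul_sin_arg]; simp [hz]
  rw [Complex.ofReal_neg, neg_neg] at hb
  simp only [rotY, rotZ, Matrix.of_apply, Matrix.cons_val_zero, Matrix.cons_val_one,
    Matrix.cons_val', Matrix.cons_val_fin_one]
  rw [ha, hb, Real.sin_neg, Real.cos_neg, ← hre, ← him]
  push_cast
  ring

/-- A circuit that acts the same way on both values of the qubit `f`. -/
def CommutesWithFlip (C : Circuit n) (f : Fin n) : Prop :=
  ∀ ψ x, act C (fun y => ψ (update y f (y f + 1))) x = act C ψ (update x f (x f + 1))

theorem CommutesWithFlip.append {C D : Circuit n} {f : Fin n} (hC : CommutesWithFlip C f)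
    (hD : CommutesWithFlip D f) : CommutesWithFlip (C ++ D) f := by
  intro ψ x
  rw [act_append, act_append, ← hD, funext (hC ψ)]

theorem commutesWithFlip_of_multiplexer {R : ℝ → Matrix.unitaryGroup (Fin 2) ℂ} {t : Fin n}
    {Q : Finset (Fin n)} {θ : Bits n → ℝ} (hθ : DependsOnly θ Q) {C : Circuit n}
    (hC : ∀ ψ x, act C ψ x = ∑ b, (R (θ x)).1 (x t) b * ψ (update x t b))
    {f : Fin n} (hft : f ≠ t) (hf : f ∉ Q) : CommutesWithFlip C f := by
  intro ψ x
  simp only [hC, hθ.update hf, update_of_ne hft.symm, update_of_ne hft]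
  simp only [update_comm hft]

/-- A vector supported on the qubits `Q` is disentangled by a circuit on these qubits. -/
theorem exists_disentangler (Q : Finset (Fin n)) (w : Bits n → ℂ)
    (hw : ∀ x, w x ≠ 0 → ∀ i, i ∉ Q → x i = 0) :
    ∃ C : Circuit n, C.length ≤ 6 * 2 ^ Q.card ∧ (∃ c : ℂ, act C w = c • ket 0) ∧
      ∀ f, f ∉ Q → CommutesWithFlip C f := by
  induction Q using Finset.induction_on generalizing w with
  | empty =>
    refine ⟨[], by simp, ⟨w 0, ?_⟩, fun f _ ψ x => by simp⟩
    ext x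
    by_cases hx : x = 0
    · subst hx; simp [ket]
    · have : w x = 0 := by
        by_contra h
        exact hx (funext fun i => hw x h i (by simp))
      simp [ket, hx, this]
  | insert t Q ht ih =>
    choose φ θ hφθ using exists_angles
    -- Projecting onto `Q` makes the angles depend on `Q` alone. Where `w` is supported nothing is
    -- lost, and the two multiplexers clear the half with `t = 1`.
    let p : Bits n → Bits n := fun x i => if i ∈ Q then x i else 0
    have hp : ∀ x y : Bits n, (∀ i ∈ Q, x i = y i) → p x = p y := by
      intro x y h
      ext i
      by_cases hi : i ∈ Q <;> simp [p, hi, h]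
    let a : Bits n → ℂ := fun x => w (p x)
    let b : Bits n → ℂ := fun x => w (update (p x) t 1)
    have hφ : DependsOnly (fun x => φ (a x) (b x)) Q := fun x y h => by simp only [a, b, hp x y h]
    have hθ : DependsOnly (fun x => θ (a x) (b x)) Q := fun x y h => by simp only [a, b, hp x y h]
    obtain ⟨A, hA, hA'⟩ := exists_multiplexer isRotation_rotZ t Q ht _ hφ
    obtain ⟨B, hB, hB'⟩ := exists_multiplexer isRotation_rotY t Q ht _ hθ
    have hφ' := fun x b => hφ.update ht x b
    beta_reduce at hφ'
    have hzero : ∀ x i, i ∉ insert t Q → x i ≠ 0 → act B (act A w) x = 0 := by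
      intro x i hi hxi
      have hit : i ≠ t := fun h => hi (by simp [h])
      have : ∀ b, w (update x t b) = 0 := by
        intro b
        by_contra h
        apply hxi
        have := hw _ h i hi
        rwa [update_of_ne hit] at this
      simp [hB', hA', this]
    obtain ⟨C, hC, ⟨c, hc⟩, hf⟩ := ih (act B (act A w)) (by
      intro x hx i hi
      by_contra hxi
      by_cases hit : i = t
      · subst hit
        have hx1 : x i = 1 := by
          revert hxi; generalize x i = y; revert y; decide
        apply hx
        by_cases hs : ∀ j, j ∉ insert i Q → x j = 0
        · have hpx : ∀ b, update (p x) i b = update x i b := by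
            intro b
            ext j
            by_cases hj : j = i
            · subst hj; simp
            · by_cases hjQ : j ∈ Q
              · simp [hj, p, hjQ]
              · simp [hj, p, hjQ, hs j (by simp [hj, hjQ])]
          have hpi : update (p x) i 0 = p x := by
            rw [update_eq_self_iff]; simp [p, ht]
          have := hφθ (a x) (b x)
          rw [hB', Fin.sum_univ_two, hA', hA', Fin.sum_univ_two, Fin.sum_univ_two]
          simp only [hφ', update_self, update_idem, hx1]
          simp only [← hpx, hpi]
          simp only [rotZ, Matrix.of_apply, Matrix.cons_val_zero, Matrix.cons_val_one,
            Matrix.cons_val', Matrix.cons_val_fin_one, zero_mul, zero_add, add_zero] at this ⊢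
          exact this
        · push Not at hs
          obtain ⟨j, hj, hj'⟩ := hs
          exact hzero x j hj hj'
      · exact hx (hzero x i (by simp [hit, hi]) hxi))
    refine ⟨A ++ B ++ C, ?_, ⟨c, by rw [act_append, act_append, hc]⟩, fun f hfQ => ?_⟩
    · simp only [List.length_append, Finset.card_insert_of_notMem ht, pow_succ]
      omega
    · rw [Finset.mem_insert, not_or] at hfQ
      exact ((commutesWithFlip_of_multiplexer hφ hA' hfQ.1 hfQ.2).append
        (commutesWithFlip_of_multiplexer hθ hB' hfQ.1 hfQ.2)).append (hf f hfQ.2)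

/-! ### Bit permutations up to phase, and multiply controlled flips with borrowed qubits -/

/-- The circuit `C` maps `|x⟩` to `|σ x⟩`, up to a phase. -/
def Realizes (C : Circuit n) (σ : Bits n → Bits n) : Prop :=
  ∃ c : Bits n → ℂ, (∀ x, ‖c x‖ = 1) ∧ ∀ ψ x, act C ψ (σ x) = c x * ψ x

theorem realizes_nil : Realizes ([] : Circuit n) id :=
  ⟨fun _ => 1, by simp, by simp⟩

theorem Realizes.append {C D : Circuit n} {σ τ : Bits n → Bits n} (hC : Realizes C σ)
    (hD : Realizes D τ) : Realizes (C ++ D) (τ ∘ σ) := by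
  obtain ⟨c, hc, hC⟩ := hC
  obtain ⟨d, hd, hD⟩ := hD
  refine ⟨fun x => d (σ x) * c x, by simp [hc, hd], fun ψ x => ?_⟩
  rw [act_append, comp_apply, hD, hC, mul_assoc]

theorem Realizes.injective {C : Circuit n} {σ : Bits n → Bits n} (hC : Realizes C σ) :
    Injective σ := by
  obtain ⟨c, hc, hC⟩ := hC
  intro x y hxy
  by_contra h
  have h1 := hC (ket x) x
  have h2 := hC (ket x) y
  rw [← hxy, h1] at h2
  have : c x ≠ 0 := by rw [← norm_ne_zero_iff, hc]; exact one_ne_zero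
  simp [ket, Ne.symm h, this] at h2

theorem realizes_cnot (c t : Fin n) (hct : c ≠ t) :
    Realizes [.cnot c t hct] (fun x => update x t (x t + x c)) := by
  refine ⟨fun _ => 1, by simp, fun ψ x => ?_⟩
  rw [act_cons, act_nil, cnot_mulVec, one_mul]
  exact congrArg ψ (update_add_involutive c t hct x)

theorem fin_two_cases (b : Fin 2) : b = 0 ∨ b = 1 := by revert b; decide

open scoped Classical in
/-- The map that flips the qubit `t` where `p` holds. -/
noncomputable def toggle (t : Fin n) (p : Bits n → Prop) (x : Bits n) : Bits n :=
  if p x then update x t (x t + 1) else x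

/-- `rotY (π / 2)` is a bit flip up to a sign, so multiplexing the angles `π / 2` and `0` suffices.
The sign is absorbed by the phase in `Realizes`. -/
theorem exists_realizes_toggle (t : Fin n) (Q : Finset (Fin n)) (ht : t ∉ Q)
    (p : Bits n → Prop) (hp : DependsOnly p Q) :
    ∃ C : Circuit n, C.length + 2 ≤ 3 * 2 ^ Q.card ∧ Realizes C (toggle t p) := by
  classical
  have hθ : DependsOnly (fun x => if p x then Real.pi / 2 else 0) Q := by
    intro x y h
    simp only [hp x y h]
  obtain ⟨C, hC, hC'⟩ := exists_multiplexer isRotation_rotY t Q ht _ hθ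
  refine ⟨C, hC, fun x => if p x then (if x t = 0 then 1 else -1) else 1, fun x => ?_,
    fun ψ x => ?_⟩
  · beta_reduce
    split_ifs <;> simp
  · rw [hC']
    unfold toggle
    by_cases h : p x
    · have h' : p (update x t (x t + 1)) := by rwa [hp.update ht]
      rw [if_pos h, if_pos h']
      simp only [h, update_self, update_idem, Fin.sum_univ_two]
      have hx : ∀ b, x t = b → update x t b = x := by rintro b rfl; simp
      rcases fin_two_cases (x t) with h0 | h1
      · simp [h0, hx 0 h0, rotY]
      · simp [h1, hx 1 h1, rotY]
    · rw [if_neg h, if_neg h]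
      simp only [h, Fin.sum_univ_two]
      have hx : ∀ b, x t = b → update x t b = x := by rintro b rfl; simp
      rcases fin_two_cases (x t) with h0 | h1
      · simp [h0, hx 0 h0, rotY]
      · simp [h1, hx 1 h1, rotY]

open scoped Classical in
/-- The map that, for all `j ≤ k`, flips the qubit `a j` if the qubits `c 0, …, c j` are zero. -/
noncomputable def ladder (c a : ℕ → Fin n) (k : ℕ) (x : Bits n) : Bits n := fun i =>
  x i + if ∃ j ≤ k, i = a j ∧ ∀ l ≤ j, x (c l) = 0 then 1 else 0

theorem ladder_of_ne {c a : ℕ → Fin n} {k : ℕ} {i : Fin n} (h : ∀ j ≤ k, i ≠ a j) (x : Bits n) :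
    ladder c a k x i = x i := by
  unfold ladder
  rw [if_neg, add_zero]
  rintro ⟨j, hj, e, -⟩
  exact h j hj e

open scoped Classical in
theorem ladder_apply {c a : ℕ → Fin n} {k : ℕ} (ha : ∀ i ≤ k, ∀ j ≤ k, a i = a j → i = j)
    {j : ℕ} (hj : j ≤ k) (x : Bits n) :
    ladder c a k x (a j) = x (a j) + if ∀ l ≤ j, x (c l) = 0 then 1 else 0 := by
  unfold ladder
  congr 1
  apply if_congr _ rfl rfl
  constructor
  · rintro ⟨j', hj', e, h⟩
    rwa [ha _ hj _ hj' e]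
  · exact fun h => ⟨j, hj, rfl, h⟩

open scoped Classical in
theorem toggle_self (t : Fin n) (p : Bits n → Prop) (x : Bits n) :
    toggle t p x t = x t + if p x then 1 else 0 := by
  unfold toggle
  split_ifs <;> simp

theorem toggle_of_ne {t i : Fin n} (h : i ≠ t) (p : Bits n → Prop) (x : Bits n) :
    toggle t p x i = x i := by
  unfold toggle
  split_ifs <;> simp [h]

/-- The two outer toggles see `a k` before and after the inner ladder changes it. Their
contributions add modulo 2, so the unknown initial value of the borrowed qubit `a k` cancels and
only the conjunction of the controls remains. -/
theorem ladder_succ {c a : ℕ → Fin n} {k : ℕ}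
    (ha : ∀ i ≤ k + 1, ∀ j ≤ k + 1, a i = a j → i = j) (hca : ∀ i ≤ k + 1, ∀ j ≤ k + 1, c i ≠ a j) :
    toggle (a (k + 1)) (fun x => x (c (k + 1)) = 0 ∧ x (a k) = 1) ∘ ladder c a k ∘
      toggle (a (k + 1)) (fun x => x (c (k + 1)) = 0 ∧ x (a k) = 1) = ladder c a (k + 1) := by
  classical
  have ha' : ∀ i ≤ k, ∀ j ≤ k, a i = a j → i = j := fun i hi j hj =>
    ha i (by omega) j (by omega)
  have hne : ∀ j ≤ k, a (k + 1) ≠ a j := fun j hj h => by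
    have := ha _ le_rfl _ (by omega) h
    omega
  ext1 x
  simp only [comp_apply]
  set p : Bits n → Prop := fun x => x (c (k + 1)) = 0 ∧ x (a k) = 1
  set y := toggle (a (k + 1)) p x with hy
  have hyc : ∀ l ≤ k + 1, y (c l) = x (c l) := fun l hl => toggle_of_ne (hca l hl _ le_rfl) _ _
  ext1 i
  by_cases hi : i = a (k + 1)
  · subst hi
    have hpz : p (ladder c a k y) ↔ x (c (k + 1)) = 0 ∧
        (x (a k) + if ∀ l ≤ k, y (c l) = 0 then 1 else 0) = 1 := by
      simp only [p]
      rw [ladder_of_ne (fun j hj => hca _ le_rfl _ (by omega)), ladder_apply ha' le_rfl,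
        hyc _ le_rfl, hy, toggle_of_ne (hne k le_rfl).symm]
    rw [toggle_self, ladder_apply ha le_rfl, ladder_of_ne hne, hy, toggle_self, ← hy]
    simp only [hpz, p]
    have h1 : (∀ l ≤ k, y (c l) = 0) ↔ ∀ l ≤ k, x (c l) = 0 :=
      forall₂_congr fun l hl => by rw [hyc l (by omega)]
    have h2 : (∀ l ≤ k + 1, x (c l) = 0) ↔ (∀ l ≤ k, x (c l) = 0) ∧ x (c (k + 1)) = 0 := by
      constructor
      · exact fun h => ⟨fun l hl => h l (by omega), h _ le_rfl⟩
      · rintro ⟨h, h'⟩ l hl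
        rcases Nat.lt_or_ge l (k + 1) with hl | hl'
        · exact h l (by omega)
        · rwa [show l = k + 1 by omega]
    simp only [h1, h2]
    have hbb : ∀ b : Fin 2, b + 1 + 1 = b := by decide
    rcases Classical.propComplete (∀ l ≤ k, x (c l) = 0) with hP | hP <;>
      rcases fin_two_cases (x (a k)) with hv | hv <;>
      rcases fin_two_cases (x (c (k + 1))) with hw | hw <;> simp [hP, hv, hw, hbb]
  · rw [toggle_of_ne hi]
    unfold ladder
    rw [hy, toggle_of_ne hi, ← hy]
    congr 1
    apply if_congr _ rfl rfl
    constructor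
    · rintro ⟨j, hj, e, h⟩
      exact ⟨j, by omega, e, fun l hl => by rw [← hyc l (by omega)]; exact h l hl⟩
    · rintro ⟨j, hj, e, h⟩
      have : j ≠ k + 1 := by rintro rfl; exact hi e
      exact ⟨j, by omega, e, fun l hl => by rw [hyc l (by omega)]; exact h l hl⟩

theorem exists_realizes_ladder (c a : ℕ → Fin n) (k : ℕ)
    (ha : ∀ i ≤ k, ∀ j ≤ k, a i = a j → i = j) (hca : ∀ i ≤ k, ∀ j ≤ k, c i ≠ a j) :
    ∃ C : Circuit n, C.length ≤ 20 * k + 4 ∧ Realizes C (ladder c a k) := by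
  classical
  induction k with
  | zero =>
    obtain ⟨C, hC, hC'⟩ := exists_realizes_toggle (a 0) {c 0}
      (by simpa using (hca 0 le_rfl 0 le_rfl).symm) (fun x => x (c 0) = 0)
      (fun x y h => by simp only [h (c 0) (by simp)])
    refine ⟨C, by simpa using hC, ?_⟩
    convert hC' using 1
    ext1 x
    ext1 i
    by_cases hi : i = a 0
    · subst hi
      rw [ladder_apply ha le_rfl, toggle_self]
      simp
    · rw [ladder_of_ne (fun j hj => by rwa [Nat.le_zero.mp hj]), toggle_of_ne hi]
  | succ k ih =>
    obtain ⟨C, hC, hC'⟩ := ih (fun i hi j hj => ha i (by omega) j (by omega))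
      (fun i hi j hj => hca i (by omega) j (by omega))
    obtain ⟨T, hT, hT'⟩ := exists_realizes_toggle (a (k + 1)) {c (k + 1), a k}
      (by
        simp only [Finset.mem_insert, Finset.mem_singleton, not_or]
        refine ⟨(hca _ le_rfl _ le_rfl).symm, fun h => ?_⟩
        have := ha _ le_rfl _ (by omega) h
        omega) (fun x => x (c (k + 1)) = 0 ∧ x (a k) = 1)
      (fun x y h => by simp only [h (c (k + 1)) (by simp), h (a k) (by simp)])
    refine ⟨T ++ C ++ T, ?_, ?_⟩
    · have h1 : ({c (k + 1), a k} : Finset (Fin n)).card ≤ 2 := Finset.card_le_two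
      have h2 := Nat.pow_le_pow_right (n := 2) (by norm_num) h1
      simp only [List.length_append]
      omega
    · rw [← ladder_succ ha hca]
      exact (hT'.append hC').append hT'

/-- A multiply controlled bit flip of linear size, which borrows the qubits `a 0, …, a (k - 1)`. -/
theorem exists_realizes_multicontrolled (c a : ℕ → Fin n) (k : ℕ)
    (ha : ∀ i ≤ k, ∀ j ≤ k, a i = a j → i = j) (hca : ∀ i ≤ k, ∀ j ≤ k, c i ≠ a j) :
    ∃ C : Circuit n, C.length ≤ 40 * k + 4 ∧
      Realizes C (toggle (a k) (fun x => ∀ l ≤ k, x (c l) = 0)) := by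
  classical
  obtain ⟨C, hC, hC'⟩ := exists_realizes_ladder c a k ha hca
  cases k with
  | zero =>
    refine ⟨C, by omega, ?_⟩
    convert hC' using 1
    ext1 x
    ext1 i
    by_cases hi : i = a 0
    · subst hi
      rw [ladder_apply ha le_rfl, toggle_self]
      congr
    · rw [ladder_of_ne (fun j hj => by rwa [Nat.le_zero.mp hj]), toggle_of_ne hi]
  | succ k =>
    have ha' : ∀ i ≤ k, ∀ j ≤ k, a i = a j → i = j := fun i hi j hj =>
      ha i (by omega) j (by omega)
    obtain ⟨D, hD, hD'⟩ := exists_realizes_ladder c a k ha'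
      (fun i hi j hj => hca i (by omega) j (by omega))
    -- The shorter ladder undoes all flips of the longer one except the last, restoring the borrowed
    -- qubits.
    refine ⟨C ++ D, by rw [List.length_append]; omega, ?_⟩
    convert hC'.append hD' using 1
    ext1 x
    have hc : ∀ l ≤ k + 1, ladder c a (k + 1) x (c l) = x (c l) := fun l hl =>
      ladder_of_ne (hca l hl) x
    ext1 i
    rw [comp_apply]
    by_cases hi : ∃ j ≤ k, i = a j
    · obtain ⟨j, hj, rfl⟩ := hi
      rw [ladder_apply ha' hj, ladder_apply ha (by omega), toggle_of_ne]
      · have : (∀ l ≤ j, ladder c a (k + 1) x (c l) = 0) ↔ ∀ l ≤ j, x (c l) = 0 :=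
          forall₂_congr fun l hl => by rw [hc l (by omega)]
        simp only [this]
        generalize x (a j) = u
        revert u
        split_ifs <;> decide
      · intro h
        have := ha _ (by omega) _ le_rfl h
        omega
    · push Not at hi
      rw [ladder_of_ne hi]
      by_cases hi' : i = a (k + 1)
      · subst hi'
        rw [ladder_apply ha le_rfl, toggle_self]
        congr
      · rw [toggle_of_ne hi', ladder_of_ne]
        intro j hj
        rcases Nat.lt_or_ge j (k + 1) with h | h
        · exact hi j (by omega)
        · rwa [show j = k + 1 by omega]

/-! ### The sign flip without ancillas -/

/-- The unknown phases of `T` cancel against those of its inverse, which is why realizing a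
permutation up to phase is enough. -/
theorem Realizes.act_conj_diagonal {T D : Circuit n} {σ : Bits n → Bits n} (hT : Realizes T σ)
    {s : Bits n → ℂ} (hD : ∀ ψ x, act D ψ x = s x * ψ x) (ψ : Bits n → ℂ) (x : Bits n) :
    act (T ++ D ++ inv T) ψ x = s (σ x) * ψ x := by
  obtain ⟨c, hc, hT⟩ := hT
  have hcx : c x ≠ 0 := by rw [← norm_ne_zero_iff, hc]; exact one_ne_zero
  have h := hT (act (inv T) (act D (act T ψ))) x
  rw [act_act_inv, hD, hT] at h
  rw [act_append, act_append]
  apply mul_left_cancel₀ hcx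
  rw [← h]
  ring

theorem act_inv_diagonal {D : Circuit n} {s : Bits n → ℂ} (hD : ∀ ψ x, act D ψ x = s x * ψ x)
    (ψ : Bits n → ℂ) (x : Bits n) : s x * act (inv D) ψ x = ψ x := by
  rw [← hD, act_act_inv]

theorem exists_enumeration (f : Fin n) : ∃ q : ℕ → Fin n, q 0 = f ∧
    (∀ i < n, ∀ j < n, q i = q j → i = j) ∧ ∀ i, ∃ j < n, q j = i := by
  have hn : 0 < n := f.pos
  let e : Equiv.Perm (Fin n) := Equiv.swap ⟨0, hn⟩ f
  refine ⟨fun i => if h : i < n then e ⟨i, h⟩ else f, by simp [hn, e], fun i hi j hj h => ?_,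
    fun i => ⟨e.symm i, (e.symm i).isLt, by simp⟩⟩
  simpa [hi, hj] using h

open scoped Classical in
/-- The sign flip of all basis states whose qubits are zero except possibly the qubit `f`. -/
theorem exists_signFlip (hn : 2 ≤ n) (f : Fin n) : ∃ C : Circuit n, C.length ≤ 140 * n ∧
    ∀ ψ x, act C ψ x = (if ∀ i, i ≠ f → x i = 0 then -1 else 1) * ψ x := by
  obtain ⟨q, rfl, hinj, hsurj⟩ := exists_enumeration f
  obtain ⟨k, hk1, hk2⟩ : ∃ k, 2 * k + 2 ≤ n ∧ n ≤ 2 * k + 3 := ⟨n / 2 - 1, by omega, by omega⟩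
  have hne : ∀ i < n, ∀ j < n, i ≠ j → q i ≠ q j := fun i hi j hj h e => h (hinj i hi j hj e)
  -- The odd and even positions serve in turn as controls and as borrowed qubits. Position `2 * k +
  -- 2`, present only for odd `n`, is left over and becomes a control of the diagonal circuit `D`.
  obtain ⟨T, hT, hT'⟩ := exists_realizes_multicontrolled (fun j => q (2 * j + 1))
    (fun j => if j = k then q 0 else q (2 * j + 2)) k
    (by
      intro i hi j hj h
      split_ifs at h
      · omega
      · have := hinj _ (by omega) _ (by omega) h
        omega
      · have := hinj _ (by omega) _ (by omega) h
        omega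
      · have := hinj _ (by omega) _ (by omega) h
        omega)
    (by
      intro i hi j hj
      split_ifs <;> exact hne _ (by omega) _ (by omega) (by omega))
  obtain ⟨S, hS, hS'⟩ := exists_realizes_multicontrolled (fun j => q (2 * j))
    (fun j => if j = k then q 1 else q (2 * j + 3)) k
    (by
      intro i hi j hj h
      split_ifs at h
      · omega
      · have := hinj _ (by omega) _ (by omega) h
        omega
      · have := hinj _ (by omega) _ (by omega) h
        omega
      · have := hinj _ (by omega) _ (by omega) h
        omega)
    (by
      intro i hi j hj
      split_ifs <;> exact hne _ (by omega) _ (by omega) (by omega))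
  rw [if_pos rfl] at hT' hS'
  set P : Bits n → Prop := fun x => ∀ l ≤ k, x (q (2 * l + 1)) = 0
  set P' : Bits n → Prop := fun x => ∀ l ≤ k, x (q (2 * l)) = 0
  let B : Bits n → Prop := fun x => 2 * k + 2 < n → x (q (2 * k + 2)) = 0
  let Q : Finset (Fin n) := if 2 * k + 2 < n then {q (2 * k + 2)} else ∅
  have hQ : Q.card ≤ 1 := by
    simp only [Q]
    split_ifs <;> simp
  have hQ' := Nat.pow_le_pow_right (n := 2) (by norm_num) hQ
  have hBQ : DependsOnly B Q := by
    intro x y h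
    by_cases hlt : 2 * k + 2 < n
    · simp only [Q, hlt, if_true, Finset.mem_singleton, forall_eq] at h
      simp only [B, h]
    · simp [B, hlt]
  have hθ : DependsOnly (fun x => if B x then Real.pi / 2 else 0) Q := by
    intro x y h
    simp only [hBQ x y h]
  have h1Q : q 1 ∉ Q := by
    by_cases hlt : 2 * k + 2 < n
    · simpa only [Q, hlt, if_true, Finset.mem_singleton] using
        hne _ (by omega) _ (by omega) (by omega)
    · simp [Q, hlt]
  have h0Q : q 0 ∉ Q := by
    by_cases hlt : 2 * k + 2 < n
    · simpa only [Q, hlt, if_true, Finset.mem_singleton] using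
        hne _ (by omega) _ (by omega) (by omega)
    · simp [Q, hlt]
  obtain ⟨D, hD, hD'⟩ := exists_multiplexer isRotation_rotZ (q 1) Q h1Q _ hθ
  let s : Bits n → ℂ := fun x =>
    if B x then (if x (q 1) = 0 then -Complex.I else Complex.I) else 1
  have hDs : ∀ ψ x, act D ψ x = s x * ψ x := by
    intro ψ x
    have hx : ∀ b, x (q 1) = b → update x (q 1) b = x := by rintro b rfl; simp
    have e1 : Complex.exp (Real.pi / 2 * Complex.I) = Complex.I := Complex.exp_pi_div_two_mul_I
    have e2 : Complex.exp (-(Real.pi / 2 * Complex.I)) = -Complex.I := by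
      rw [Complex.exp_neg, e1, Complex.inv_I]
    rw [hD', Fin.sum_univ_two]
    rcases fin_two_cases (x (q 1)) with h0 | h1
    · by_cases hB : B x <;> simp [s, h0, hx 0 h0, rotZ, hB, e2]
    · by_cases hB : B x <;> simp [s, h1, hx 1 h1, rotZ, hB, e1]
  -- A commutator: where `P'` holds, `S` flips `q 1` and exchanges the phases `-i` and `i`, whose
  -- ratio is `-1`.
  let W : Circuit n := S ++ D ++ inv S ++ inv D
  have hW : ∀ ψ x, act W ψ x = (if P' x ∧ B x then -1 else 1) * ψ x := by
    intro ψ x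
    have h1 := act_inv_diagonal hDs (act (S ++ D ++ inv S) ψ) x
    rw [hS'.act_conj_diagonal hDs] at h1
    have hs : s x ≠ 0 := by
      simp only [s]
      split_ifs <;> simp
    have hBt : B (toggle (q 1) P' x) = B x := by
      unfold toggle
      split_ifs
      · exact hBQ.update h1Q _ _
      · rfl
    have h2 : s (toggle (q 1) P' x) = s x * (if P' x ∧ B x then -1 else 1) := by
      simp only [s, hBt, toggle_self]
      rcases fin_two_cases (x (q 1)) with h0 | h1 <;> by_cases hB : B x <;>
        by_cases hP : P' x <;> simp [*]
    rw [h2] at h1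
    rw [act_append]
    apply mul_left_cancel₀ hs
    rw [h1, mul_assoc]
  -- A second commutator removes the dependence on `f = q 0`: where `P` holds, `T` flips `q 0`, so
  -- exactly one of the two copies of `W` sees `q 0 = 0`; elsewhere both agree and their signs
  -- cancel.
  refine ⟨T ++ W ++ inv T ++ W, ?_, fun ψ x => ?_⟩
  · simp only [W, List.length_append, length_inv]
    omega
  · rw [act_append, hW, hT'.act_conj_diagonal hW, ← mul_assoc]
    congr 1
    have hBt : B (toggle (q 0) P x) = B x := by
      unfold toggle
      split_ifs
      · exact hBQ.update h0Q _ _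
      · rfl
    let P'' : Bits n → Prop := fun x => ∀ l ≤ k, l ≠ 0 → x (q (2 * l)) = 0
    have hP' : ∀ y, P' y ↔ y (q 0) = 0 ∧ P'' y := by
      intro y
      constructor
      · exact fun h => ⟨h 0 (by omega), fun l hl _ => h l hl⟩
      · rintro ⟨h, h'⟩ l hl
        by_cases h0 : l = 0
        · subst h0; exact h
        · exact h' l hl h0
    have hPt : P'' (toggle (q 0) P x) ↔ P'' x :=
      forall₃_congr fun l hl h0 => by
        rw [toggle_of_ne (hne _ (by omega) _ (by omega) (by omega))]
    have hall : (∀ i, i ≠ q 0 → x i = 0) ↔ P x ∧ P'' x ∧ B x := by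
      constructor
      · intro h
        refine ⟨fun l hl => h _ ?_, fun l hl h0 => h _ ?_, fun hlt => h _ ?_⟩ <;>
          exact hne _ (by omega) _ (by omega) (by omega)
      · rintro ⟨h1, h2, h3⟩ i hi
        obtain ⟨j, hj, rfl⟩ := hsurj i
        have hj0 : j ≠ 0 := by rintro rfl; exact hi rfl
        rcases Nat.even_or_odd' j with ⟨l, rfl | rfl⟩
        · by_cases hl : l ≤ k
          · exact h2 l hl (by omega)
          · rw [show 2 * l = 2 * k + 2 by omega]
            exact h3 (by omega)
        · exact h1 l (by omega)
    simp only [hP', hBt, hPt, toggle_self, hall]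
    rcases fin_two_cases (x (q 0)) with h0 | h1 <;> by_cases hB : B x <;>
        by_cases hP : P x <;> by_cases hP2 : P'' x <;> simp [*]

/-! ### Compression of bit strings by CNOT gates -/

theorem fin_two_add_self (a : Fin 2) : a + a = 0 := by revert a; decide

theorem fin_two_add_cancel (a b : Fin 2) : a + b + b = a := by revert a b; decide

/-- Representatives are fixed by `rep`, so no control is ever a target and the CNOTs do not
interfere. -/
theorem exists_realizes_fan_on (rep : Fin n → Fin n) (hrep : ∀ i, rep (rep i) = rep i)
    (B : Finset (Fin n)) (hB : ∀ i ∈ B, rep i ≠ i) :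
    ∃ C : Circuit n, C.length ≤ B.card ∧
      Realizes C (fun x i => if i ∈ B then x i + x (rep i) else x i) := by
  induction B using Finset.induction_on with
  | empty => exact ⟨[], by simp, by simp only [Finset.notMem_empty, if_false]; exact realizes_nil⟩
  | insert t B ht ih =>
    obtain ⟨C, hC, hC'⟩ := ih fun i hi => hB i (by simp [hi])
    have hrt := hB t (by simp)
    have hr : rep t ∉ B := fun h => hB (rep t) (by simp [h]) (hrep t)
    refine ⟨C ++ [.cnot (rep t) t hrt], ?_, ?_⟩
    · rw [List.length_append, Finset.card_insert_of_notMem ht]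
      simpa using hC
    · convert hC'.append (realizes_cnot (rep t) t hrt) using 1
      ext1 x
      ext1 i
      by_cases hi : i = t
      · subst hi
        simp [ht, hr]
      · simp [hi]

/-- CNOT gates that add to every qubit its representative. -/
theorem exists_realizes_fan (rep : Fin n → Fin n) (hrep : ∀ i, rep (rep i) = rep i) :
    ∃ C : Circuit n, C.length ≤ (Finset.univ.filter fun i => rep i ≠ i).card ∧
      Realizes C (fun x i => if rep i ≠ i then x i + x (rep i) else x i) := by
  obtain ⟨C, hC, hC'⟩ := exists_realizes_fan_on rep hrep (Finset.univ.filter fun i => rep i ≠ i)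
    (fun i hi => by simpa using hi)
  exact ⟨C, hC, by simpa only [Finset.mem_filter, Finset.mem_univ, true_and] using hC'⟩

theorem exists_realizes_fanOut (p : Fin n) (B : Finset (Fin n)) (hp : p ∉ B) :
    ∃ C : Circuit n, C.length ≤ B.card ∧
      Realizes C (fun x i => if i ∈ B then x i + x p else x i) := by
  obtain ⟨C, hC, hC'⟩ := exists_realizes_fan_on (fun i => if i ∈ B then p else i)
    (fun i => by by_cases h : i ∈ B <;> simp [h, hp]) B
    (fun i hi => by rw [if_pos hi]; rintro rfl; exact hp hi)
  refine ⟨C, hC, ?_⟩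
  convert hC' using 1
  ext1 x
  ext1 i
  by_cases h : i ∈ B <;> simp [h]

/-- Gaussian elimination: few bit strings on the qubits `A` are compressed by CNOT gates to as
many qubits as there are strings. -/
theorem exists_elimination (A : Finset (Fin n)) (X : Finset (Bits n))
    (hX : ∀ x ∈ X, ∀ i, i ∉ A → x i = 0) :
    ∃ (C : Circuit n) (σ : Bits n → Bits n) (Q : Finset (Fin n)),
      C.length ≤ X.card * A.card ∧ Realizes C σ ∧ Q.card ≤ X.card ∧
      (∀ x ∈ X, ∀ i, i ∉ Q → σ x i = 0) ∧
      ∀ x, (∀ i, i ∉ A → x i = 0) → ∀ i, i ∉ A → σ x i = 0 := by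
  classical
  induction X using Finset.induction_on with
  | empty => exact ⟨[], id, ∅, by simp, realizes_nil, by simp, by simp, by simp⟩
  | insert x X hx ih =>
    obtain ⟨C, σ, Q, hC, hσ, hQ, hXQ, hA⟩ := ih fun y hy => hX y (by simp [hy])
    rw [Finset.card_insert_of_notMem hx]
    by_cases hxQ : ∀ i, i ∉ Q → σ x i = 0
    · refine ⟨C, σ, Q, hC.trans (Nat.mul_le_mul_right _ (by omega)), hσ, by omega, ?_, hA⟩
      intro y hy
      rcases Finset.mem_insert.mp hy with rfl | hy
      · exact hxQ
      · exact hXQ y hy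
    · push Not at hxQ
      obtain ⟨p, hpQ, hp⟩ := hxQ
      have hp1 : σ x p = 1 := (fin_two_cases _).resolve_left hp
      have hxA := hA x (hX x (by simp))
      -- The pivot `p` clears the other ones of `σ x` outside `Q`. Earlier strings vanish at `p` and
      -- are unaffected.
      obtain ⟨D, hD, hD'⟩ := exists_realizes_fanOut p
        (A.filter fun i => i ∉ Q ∧ i ≠ p ∧ σ x i = 1) (by simp)
      refine ⟨C ++ D, _, insert p Q, ?_, hσ.append hD', ?_, ?_, ?_⟩
      · rw [List.length_append, add_mul, one_mul]
        exact add_le_add hC (hD.trans (Finset.card_filter_le _ _))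
      · exact (Finset.card_insert_le _ _).trans (by omega)
      · intro y hy i hi
        rw [Finset.mem_insert, not_or] at hi
        simp only [comp_apply, Finset.mem_filter]
        rcases Finset.mem_insert.mp hy with rfl | hy
        · by_cases hi0 : σ y i = 0
          · simp [hi0]
          · have hi1 : σ y i = 1 := (fin_two_cases _).resolve_left hi0
            have hiA : i ∈ A := by
              by_contra h
              exact hi0 (hxA i h)
            rw [if_pos ⟨hiA, hi.2, hi.1, hi1⟩, hi1, hp1]
            rfl
        · rw [hXQ y hy i hi.2, hXQ y hy p hpQ]
          simp
      · intro y hy i hi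
        simp [hi, hA y hy i hi]

/-- Few bit strings are compressed by CNOT gates to as many qubits as there are strings. -/
theorem exists_compression (hn : 0 < n) (X : Finset (Bits n)) :
    ∃ (C : Circuit n) (σ : Bits n → Bits n) (Q : Finset (Fin n)),
      C.length ≤ n + X.card * 2 ^ X.card ∧ Realizes C σ ∧ Q.card ≤ X.card ∧
      ∀ x ∈ X, ∀ i, i ∉ Q → σ x i = 0 := by
  classical
  have : Nonempty (Fin n) := ⟨⟨0, hn⟩⟩
  -- Qubits with equal columns carry the same bit on all of `X`. One representative per column
  -- remains; adding it to the others makes them zero.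
  let col : Fin n → (X → Fin 2) := fun i x => x.1 i
  let rep : Fin n → Fin n := fun i => invFun col (col i)
  have hcol : ∀ i, col (rep i) = col i := fun i => invFun_eq ⟨i, rfl⟩
  have hrep : ∀ i, rep (rep i) = rep i := fun i => congrArg (invFun col) (hcol i)
  obtain ⟨C, hC, hC'⟩ := exists_realizes_fan rep hrep
  set τ : Bits n → Bits n := fun x i => if rep i ≠ i then x i + x (rep i) else x i
  let A : Finset (Fin n) := Finset.univ.image (invFun col)
  have hA : A.card ≤ 2 ^ X.card := by
    refine Finset.card_image_le.trans ?_
    simp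
  obtain ⟨D, σ, Q, hD, hσ, hQ, hXQ, -⟩ := exists_elimination A (X.image τ) (by
    intro y hy i hi
    obtain ⟨x, hx, rfl⟩ := Finset.mem_image.mp hy
    have : rep i ≠ i := by
      intro h
      apply hi
      rw [← h]
      exact Finset.mem_image_of_mem _ (Finset.mem_univ _)
    have hxi : x (rep i) = x i := congrFun (hcol i) ⟨x, hx⟩
    simp only [τ]
    rw [if_pos this, hxi, fin_two_add_self])
  have hXc : (X.image τ).card ≤ X.card := Finset.card_image_le
  refine ⟨C ++ D, σ ∘ τ, Q, ?_, hC'.append hσ, hQ.trans hXc, fun x hx =>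
    hXQ _ (Finset.mem_image_of_mem _ hx)⟩
  rw [List.length_append]
  refine add_le_add (hC.trans ?_) (hD.trans (Nat.mul_le_mul hXc hA))
  exact (Finset.card_filter_le _ _).trans (by simp)

/-! ### Supports and Householder reflections -/

open scoped Classical in
/-- The basis states with non-zero amplitude. -/
noncomputable def supp (ψ : Bits n → ℂ) : Finset (Bits n) := Finset.univ.filter fun x => ψ x ≠ 0

@[simp] theorem mem_supp {ψ : Bits n → ℂ} {x : Bits n} : x ∈ supp ψ ↔ ψ x ≠ 0 := by
  simp [supp]

theorem Realizes.act_ne_zero_iff {C : Circuit n} {σ : Bits n → Bits n} (hC : Realizes C σ)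
    (ψ : Bits n → ℂ) (x : Bits n) : act C ψ (σ x) ≠ 0 ↔ ψ x ≠ 0 := by
  obtain ⟨c, hc, hC⟩ := hC
  have hcx : c x ≠ 0 := by rw [← norm_ne_zero_iff, hc]; exact one_ne_zero
  simp [hC, hcx]

theorem Realizes.card_supp {C : Circuit n} {σ : Bits n → Bits n} (hC : Realizes C σ)
    (ψ : Bits n → ℂ) : (supp (act C ψ)).card = (supp ψ).card := by
  classical
  have hs : Surjective σ := Finite.injective_iff_surjective.mp hC.injective
  rw [← Finset.card_image_of_injective (supp ψ) hC.injective]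
  congr 1
  ext y
  obtain ⟨x, rfl⟩ := hs y
  rw [mem_supp, hC.act_ne_zero_iff]
  simp [hC.injective.eq_iff]

theorem star_ket_dotProduct (x : Bits n) (ψ : Bits n → ℂ) : star (ket x) ⬝ᵥ ψ = ψ x := by
  have : star (ket x) = ket x := by
    ext y
    by_cases h : y = x
    · subst h; simp [ket]
    · simp [ket, h]
  rw [this, ket, single_one_dotProduct]

/-- A reflection about a vector on few qubits, applied to a state that vanishes on the copy of the
vector with the qubit `f` flipped. -/
theorem exists_reflection (hn : 2 ≤ n) (Q : Finset (Fin n)) {f : Fin n} (hf : f ∉ Q)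
    (w ψ : Bits n → ℂ) (hw0 : w ≠ 0) (hw : ∀ x, w x ≠ 0 → ∀ i, i ∉ Q → x i = 0)
    (hψ : ∀ x, w x ≠ 0 → ψ (update x f (x f + 1)) = 0) :
    ∃ C : Circuit n, C.length ≤ 12 * 2 ^ Q.card + 140 * n ∧
      act C ψ = ψ - (2 * (star w ⬝ᵥ ψ) / (star w ⬝ᵥ w)) • w := by
  classical
  obtain ⟨E, hE, ⟨c, hc⟩, hflip⟩ := exists_disentangler Q w hw
  obtain ⟨Z, hZ, hZ'⟩ := exists_signFlip hn f
  have hinner : ∀ φ, star w ⬝ᵥ φ = star c * act E φ 0 := by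
    intro φ
    rw [← star_act_dotProduct_act E, hc, star_smul, smul_dotProduct, star_ket_dotProduct,
      smul_eq_mul]
  have hw' : w = c • act (inv E) (ket 0) := by
    rw [← act_smul, ← hc, act_inv_act]
  have hc0 : c ≠ 0 := by
    rintro rfl
    exact hw0 (by rw [hw', zero_smul])
  -- `E` commutes with the flip of `f`, so this amplitude is, up to the nonzero factor `star c`, the
  -- inner product of `w` with the flipped `ψ`, which vanishes by `hψ`. Hence `Z` acts on `act E ψ`
  -- as the reflection at `|0⟩` alone.
  have hef : act E ψ (update 0 f 1) = 0 := by
    have h1 := hflip f hf ψ 0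
    have h2 := hinner fun y => ψ (update y f (y f + 1))
    rw [h1, dotProduct, Finset.sum_eq_zero] at h2
    · simpa [hc0] using h2.symm
    · intro x _
      by_cases hx : w x = 0
      · simp [hx]
      · simp [hψ x hx]
  have hww : star w ⬝ᵥ w = star c * c := by
    rw [hinner, hc]
    simp [ket]
  have hrefl : act Z (act E ψ) = act E ψ - (2 * act E ψ 0) • ket 0 := by
    ext x
    rw [hZ']
    by_cases hx : x = 0
    · subst hx
      simp [ket]
      ring
    · by_cases hx' : ∀ i, i ≠ f → x i = 0
      · have : x = update (0 : Bits n) f 1 := by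
          ext1 i
          by_cases hi : i = f
          · subst hi
            rw [update_self]
            refine (fin_two_cases _).resolve_left fun h => hx ?_
            ext1 j
            by_cases hj : j = i
            · subst hj; exact h
            · exact hx' j hj
          · rw [update_of_ne hi, hx' i hi]; rfl
        subst this
        simp [hef, ket, hx]
      · rw [if_neg hx']
        simp [ket, hx]
  refine ⟨E ++ Z ++ inv E, ?_, ?_⟩
  · simp only [List.length_append, length_inv]
    omega
  · rw [act_append, act_append, hrefl, act_sub, act_inv_act, act_smul, hww, hinner ψ]
    conv_rhs => rw [hw', smul_smul]
    have hsc : star c ≠ 0 := star_ne_zero.mpr hc0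
    congr 2
    field_simp

/-- The Householder reflection that merges the amplitudes of the strings in `X` into one. -/
theorem exists_merge (hn : 2 ≤ n) (Q : Finset (Fin n)) {f : Fin n} (hf : f ∉ Q)
    (ψ : Bits n → ℂ) (X : Finset (Bits n)) (hXQ : ∀ x ∈ X, ∀ i, i ∉ Q → x i = 0)
    (hXf : ∀ x ∈ X, ψ (update x f (x f + 1)) = 0) {y : Bits n} (hy : y ∈ X) (hψy : ψ y ≠ 0) :
    ∃ C : Circuit n, C.length ≤ 12 * 2 ^ Q.card + 140 * n ∧
      ∀ x, act C ψ x ≠ 0 → (ψ x ≠ 0 ∧ x ∉ X) ∨ x = y := by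
  classical
  let z : Bits n → ℂ := fun x => if x ∈ X then ψ x else 0
  let N : ℝ := Real.sqrt (∑ x, ‖z x‖ ^ 2)
  have hzy : z y = ψ y := if_pos hy
  have hsum : 0 < ∑ x, ‖z x‖ ^ 2 := by
    refine Finset.sum_pos' (fun _ _ => by positivity) ⟨y, Finset.mem_univ _, ?_⟩
    rw [hzy]
    positivity
  have hN : 0 < N := Real.sqrt_pos.mpr hsum
  have hN2 : (N : ℂ) ^ 2 = ∑ x, (‖z x‖ : ℂ) ^ 2 := by
    have : N ^ 2 = ∑ x, ‖z x‖ ^ 2 := Real.sq_sqrt hsum.le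
    exact_mod_cast this
  have hzz : star z ⬝ᵥ z = (N : ℂ) ^ 2 := by
    rw [hN2, dotProduct]
    refine Finset.sum_congr rfl fun x _ => ?_
    exact Complex.conj_mul' (z x)
  have hzψ : star z ⬝ᵥ ψ = (N : ℂ) ^ 2 := by
    rw [← hzz, dotProduct, dotProduct]
    refine Finset.sum_congr rfl fun x _ => ?_
    by_cases hx : x ∈ X <;> simp [z, hx]
  have hp : (‖ψ y‖ : ℂ) ≠ 0 := by exact_mod_cast norm_ne_zero_iff.mpr hψy
  have hN0 : (N : ℂ) ≠ 0 := by exact_mod_cast hN.ne'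
  -- With the phase of `ψ y` and modulus `N`, the vector `w = z + u|y⟩` is nonzero and satisfies
  -- `2⟨w, ψ⟩ = ⟨w, w⟩`. The reflection therefore subtracts exactly `w`, leaving `-u` at `y` and
  -- zero on the rest of `X`.
  let u : ℂ := N / ‖ψ y‖ * ψ y
  have hsu : star u = N / ‖ψ y‖ * star (ψ y) := by simp [u]
  have hpp : star (ψ y) * ψ y = (‖ψ y‖ : ℂ) ^ 2 := Complex.conj_mul' _
  have huψ : star u * ψ y = N * ‖ψ y‖ := by
    rw [hsu, mul_assoc, hpp]
    field_simp
  have huu : star u * u = (N : ℂ) ^ 2 := by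
    rw [hsu, mul_mul_mul_comm, hpp]
    field_simp
  have hψu : star (ψ y) * u = N * ‖ψ y‖ := by
    rw [mul_left_comm, hpp]
    field_simp
  let w : Bits n → ℂ := z + u • ket y
  have hwψ : star w ⬝ᵥ ψ = (N : ℂ) ^ 2 + N * ‖ψ y‖ := by
    rw [star_add, star_smul, add_dotProduct, smul_dotProduct, star_ket_dotProduct, hzψ,
      smul_eq_mul, huψ]
  have hzk : star z ⬝ᵥ ket y = star (ψ y) := by
    rw [ket, dotProduct_single_one, Pi.star_apply, hzy]
  have hkk : star (ket y) ⬝ᵥ ket y = 1 := by rw [star_ket_dotProduct]; simp [ket]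
  have hww : star w ⬝ᵥ w = 2 * ((N : ℂ) ^ 2 + N * ‖ψ y‖) := by
    simp only [w]
    rw [star_add, star_smul, add_dotProduct, smul_dotProduct, dotProduct_add, dotProduct_add,
      dotProduct_smul, dotProduct_smul, star_ket_dotProduct, hzz, hzk, hkk, hzy, smul_eq_mul,
      smul_eq_mul, smul_eq_mul, mul_comm u, hψu, mul_add, huψ, mul_one, huu]
    ring
  have hpos : (N : ℂ) ^ 2 + N * ‖ψ y‖ ≠ 0 := by
    have : 0 < N ^ 2 + N * ‖ψ y‖ := by positivity
    exact_mod_cast this.ne'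
  have hwX : ∀ x, w x ≠ 0 → x ∈ X := by
    intro x hx
    by_contra h
    have hxy : x ≠ y := by rintro rfl; exact h hy
    simp [w, z, h, ket, hxy] at hx
  obtain ⟨C, hC, hC'⟩ := exists_reflection hn Q hf w ψ
    (by
      intro h
      rw [h] at hww
      rw [dotProduct_zero, zero_eq_mul] at hww
      exact hww.elim two_ne_zero hpos)
    (fun x hx => hXQ x (hwX x hx)) (fun x hx => hXf x (hwX x hx))
  refine ⟨C, hC, fun x hx => ?_⟩
  rw [hC', hwψ, hww, div_self (mul_ne_zero two_ne_zero hpos), one_smul] at hx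
  by_cases hxy : x = y
  · exact Or.inr hxy
  · left
    by_cases hxX : x ∈ X
    · simp [w, z, hxX, ket, hxy] at hx
    · exact ⟨by simpa [w, z, hxX, ket, hxy] using hx, hxX⟩

theorem card_supported_le (Q : Finset (Fin n)) :
    (Finset.univ.filter fun x : Bits n => ∀ i, i ∉ Q → x i = 0).card ≤ 2 ^ Q.card := by
  have : 2 ^ Q.card = (Finset.univ : Finset (Q → Fin 2)).card := by simp
  rw [this]
  apply Finset.card_le_card_of_injOn (fun x i => x i.1)
    (fun _ _ => Finset.mem_coe.mpr (Finset.mem_univ _))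
  intro x hx y hy h
  simp only [Finset.coe_filter, Finset.mem_univ, true_and, Set.mem_ofPred_eq] at hx hy
  ext1 i
  by_cases hi : i ∈ Q
  · exact congrFun h ⟨i, hi⟩
  · rw [hx i hi, hy i hi]

/-! ### Reduction of the support -/

/-- A circuit of linear size merges logarithmically many amplitudes of a sparse state. -/
theorem exists_reduction (hn : 2 ≤ n) (ψ : Bits n → ℂ) (X : Finset (Bits n)) (hX : X ⊆ supp ψ)
    (hne : X.Nonempty) {m : ℕ} (hXm : X.card ≤ m) (hm : (supp ψ).card * m + 2 ^ m < 2 ^ n) :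
    ∃ C : Circuit n, C.length ≤ 142 * n + (m + 12) * 2 ^ m ∧
      (supp (act C ψ)).card + X.card ≤ (supp ψ).card + 1 := by
  classical
  obtain ⟨C, σ, Q, hC, hσ, hQ, hXQ⟩ := exists_compression (by omega) X
  set φ := act C ψ with hφ
  set Y := X.image σ with hY
  have hYQ : ∀ x ∈ Y, ∀ i, i ∉ Q → x i = 0 := by
    intro x hx
    obtain ⟨y, hy, rfl⟩ := Finset.mem_image.mp hx
    exact hXQ y hy
  have hYX : Y.card = X.card := Finset.card_image_of_injective _ hσ.injective
  have hφc : (supp φ).card = (supp ψ).card := hσ.card_supp ψ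
  have hYφ : Y ⊆ supp φ := by
    intro x hx
    obtain ⟨y, hy, rfl⟩ := Finset.mem_image.mp hx
    rw [mem_supp, hφ, hσ.act_ne_zero_iff]
    exact mem_supp.mp (hX hy)
  have hpow : 2 ^ X.card ≤ 2 ^ m := Nat.pow_le_pow_right (by norm_num) hXm
  have hpowQ : 2 ^ Q.card ≤ 2 ^ m := Nat.pow_le_pow_right (by norm_num) (hQ.trans hXm)
  -- By counting, some shift `v` moves every string of `Y` off the support and has a one outside
  -- `Q`; `hm` bounds the number of excluded shifts.
  obtain ⟨v, hv⟩ : ∃ v : Bits n, v ∉ ((Y ×ˢ supp φ).image fun p => p.1 + p.2) ∪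
      Finset.univ.filter fun x : Bits n => ∀ i, i ∉ Q → x i = 0 := by
    by_contra! h
    have h1 : (Finset.univ : Finset (Bits n)).card ≤ _ :=
      Finset.card_le_card fun x _ => h x
    have h2 := h1.trans (Finset.card_union_le _ _)
    have h3 : ((Y ×ˢ supp φ).image fun p => p.1 + p.2).card ≤ m * (supp ψ).card := by
      refine Finset.card_image_le.trans ?_
      rw [Finset.card_product, hYX, hφc]
      exact Nat.mul_le_mul_right _ hXm
    have h4 := card_supported_le Q
    have h5 : (Finset.univ : Finset (Bits n)).card = 2 ^ n := by simp
    rw [mul_comm m] at h3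
    omega
  rw [Finset.mem_union, not_or, Finset.mem_image, Finset.mem_filter] at hv
  obtain ⟨hv1, hv2⟩ := hv
  simp only [Finset.mem_univ, true_and] at hv2
  push Not at hv2
  obtain ⟨f, hfQ, hvf⟩ := hv2
  have hvf1 : v f = 1 := (fin_two_cases _).resolve_left hvf
  have hYv : ∀ x ∈ Y, φ (x + v) = 0 := by
    intro x hx
    by_contra h
    refine hv1 ⟨(x, x + v), Finset.mem_product.mpr ⟨hx, mem_supp.mpr h⟩, ?_⟩
    ext1 i
    simp only [Pi.add_apply]
    rw [← add_assoc, fin_two_add_self, zero_add]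
  -- This fan-out fixes `Y`, whose strings vanish at `f`, and turns the shift by `v` into a flip of
  -- `f` alone.
  obtain ⟨D, hD, hτ⟩ := exists_realizes_fanOut f
    (Finset.univ.filter fun i => i ≠ f ∧ v i = 1) (by simp)
  set τ : Bits n → Bits n := fun x i =>
    if i ∈ Finset.univ.filter (fun i => i ≠ f ∧ v i = 1) then x i + x f else x i with hτdef
  have hτY : ∀ x ∈ Y, τ x = x := by
    intro x hx
    ext1 i
    simp only [τ]
    rw [hYQ x hx f hfQ, add_zero, ite_self]
  have hτv : ∀ x ∈ Y, τ (x + v) = update x f (x f + 1) := by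
    intro x hx
    ext1 i
    simp only [τ, Finset.mem_filter, Finset.mem_univ, true_and, Pi.add_apply]
    by_cases hi : i = f
    · subst hi; simp [hvf1]
    · rw [update_of_ne hi]
      by_cases hvi : v i = 1
      · rw [if_pos ⟨hi, hvi⟩, hvi, hvf1, hYQ x hx f hfQ, zero_add, fin_two_add_cancel]
      · rw [if_neg (fun h => hvi h.2), (fin_two_cases _).resolve_right hvi, add_zero]
  obtain ⟨x₀, hx₀⟩ := hne
  have hy₀ : σ x₀ ∈ Y := Finset.mem_image_of_mem _ hx₀
  have hYD : ∀ x ∈ Y, act D φ x ≠ 0 := by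
    intro x hx
    have := (hτ.act_ne_zero_iff φ x).mpr (mem_supp.mp (hYφ hx))
    rwa [hτY x hx] at this
  obtain ⟨E, hE, hE'⟩ := exists_merge hn Q hfQ (act D φ) Y hYQ
    (fun x hx => by
      rw [← hτv x hx]
      by_contra h
      exact (hτ.act_ne_zero_iff φ _).mp h (hYv x hx)) hy₀ (hYD _ hy₀)
  refine ⟨C ++ D ++ E, ?_, ?_⟩
  · have h1 : D.length ≤ n := hD.trans ((Finset.card_filter_le _ _).trans (by simp))
    have h2 : X.card * 2 ^ X.card ≤ m * 2 ^ m := Nat.mul_le_mul hXm hpow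
    simp only [List.length_append]
    rw [add_mul]
    omega
  · rw [act_append, act_append, ← hφ]
    have hsub : supp (act E (act D φ)) ⊆ insert (σ x₀) (supp (act D φ) \ Y) := by
      intro x hx
      rcases hE' x (mem_supp.mp hx) with ⟨h1, h2⟩ | h
      · exact Finset.mem_insert_of_mem (Finset.mem_sdiff.mpr ⟨mem_supp.mpr h1, h2⟩)
      · exact Finset.mem_insert.mpr (Or.inl h)
    have h1 := (Finset.card_le_card hsub).trans (Finset.card_insert_le _ _)
    have hYs : Y ⊆ supp (act D φ) := fun x hx => mem_supp.mpr (hYD x hx)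
    have h2 := Finset.card_sdiff_add_card_eq_card hYs
    have h3 : (supp (act D φ)).card = (supp ψ).card := (hτ.card_supp φ).trans hφc
    omega

theorem eq_smul_ket_of_card_supp_le_one (ψ : Bits n → ℂ) (h : (supp ψ).card ≤ 1) :
    ∃ (z : Bits n) (c : ℂ), ψ = c • ket z := by
  have hz : ∀ z, (∀ x, ψ x ≠ 0 → x = z) → ψ = ψ z • ket z := by
    intro z h
    ext x
    by_cases hx : x = z
    · subst hx; simp [ket]
    · simpa [ket, hx] using mt (h x) hx
  rcases (supp ψ).eq_empty_or_nonempty with h0 | ⟨z, hz'⟩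
  · refine ⟨0, ψ 0, hz 0 fun x hx => ?_⟩
    have := mem_supp.mpr hx
    simp [h0] at this
  · exact ⟨z, ψ z, hz z fun x hx => Finset.card_le_one.mp h x (mem_supp.mpr hx) z hz'⟩

/-- Repeated reduction of a sparse state to a single basis state. -/
theorem exists_reduction_to_ket (hn : 2 ≤ n) {k : ℕ} (hk : 0 < k) (ψ : Bits n → ℂ)
    (hm : (supp ψ).card * (k + 1) + 2 ^ (k + 1) < 2 ^ n) :
    ∃ (C : Circuit n) (z : Bits n) (c : ℂ), act C ψ = c • ket z ∧
      k * C.length ≤ (142 * n + (k + 1 + 12) * 2 ^ (k + 1)) * ((supp ψ).card + k) := by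
  induction h : (supp ψ).card using Nat.strong_induction_on generalizing ψ with
  | _ s ih =>
    rw [h] at hm
    set B := 142 * n + (k + 1 + 12) * 2 ^ (k + 1) with hB
    rcases Nat.lt_or_ge s 2 with hs | hs
    · obtain ⟨z, c, hz⟩ := eq_smul_ket_of_card_supp_le_one ψ (by omega)
      exact ⟨[], z, c, by simpa using hz, by simp⟩
    · obtain ⟨X, hX, hXc⟩ := Finset.exists_subset_card_eq
        (show min (k + 1) s ≤ (supp ψ).card by omega)
      obtain ⟨C, hC, hC'⟩ := exists_reduction hn ψ X hX (Finset.card_pos.mp (by omega))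
        (show X.card ≤ k + 1 by omega) (by rwa [h])
      rw [← hB] at hC
      rcases Nat.lt_or_ge (k + 1) s with hks | hks
      · have hlt : (supp (act C ψ)).card + k ≤ s := by omega
        obtain ⟨D, z, c, hD, hD'⟩ := ih _ (by omega) (act C ψ)
          (lt_of_le_of_lt (Nat.add_le_add_right (Nat.mul_le_mul_right _ (by omega)) _) hm) rfl
        refine ⟨C ++ D, z, c, by rw [act_append, hD], ?_⟩
        rw [List.length_append, mul_add]
        calc k * C.length + k * D.length ≤ k * B + B * s :=
              add_le_add (Nat.mul_le_mul_left _ hC) (hD'.trans (Nat.mul_le_mul_left _ hlt))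
          _ = B * (s + k) := by ring
      · obtain ⟨z, c, hz⟩ := eq_smul_ket_of_card_supp_le_one (act C ψ) (by omega)
        refine ⟨C, z, c, hz, ?_⟩
        calc k * C.length ≤ k * B := Nat.mul_le_mul_left _ hC
          _ ≤ B * (s + k) := by rw [mul_comm]; exact Nat.mul_le_mul_left _ (by omega)

/-! ### From a basis state to the preparation circuit -/

theorem Realizes.act_ket {C : Circuit n} {σ : Bits n → Bits n} (hC : Realizes C σ) (x : Bits n) :
    ∃ c : ℂ, act C (ket x) = c • ket (σ x) := by
  have hσ := hC.injective
  have hs : Surjective σ := Finite.injective_iff_surjective.mp hσ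
  obtain ⟨c, -, hC⟩ := hC
  refine ⟨c x, ?_⟩
  ext y
  obtain ⟨y, rfl⟩ := hs y
  rw [hC]
  by_cases h : y = x
  · subst h; simp [ket]
  · simp [ket, h, hσ.eq_iff]

theorem exists_act_ket_eq_smul_ket_zero (B : Finset (Fin n)) (z : Bits n)
    (hz : ∀ i, i ∉ B → z i = 0) :
    ∃ C : Circuit n, C.length ≤ B.card ∧ ∃ c : ℂ, act C (ket z) = c • ket 0 := by
  induction B using Finset.induction_on generalizing z with
  | empty =>
    have : z = 0 := funext fun i => hz i (by simp)
    exact ⟨[], by simp, 1, by simp [this]⟩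
  | insert t B ht ih =>
    obtain ⟨C, hC, hC'⟩ := exists_realizes_toggle t ∅ (by simp) (fun _ => z t = 1)
      (fun _ _ _ => rfl)
    obtain ⟨c, hc⟩ := hC'.act_ket z
    obtain ⟨D, hD, d, hd⟩ := ih (toggle t (fun _ => z t = 1) z) (by
      intro i hi
      by_cases hit : i = t
      · subst hit
        rw [toggle_self]
        rcases fin_two_cases (z i) with h | h <;> simp [h]
      · rw [toggle_of_ne hit]
        exact hz i (by simp [hit, hi]))
    refine ⟨C ++ D, ?_, c * d, ?_⟩
    · rw [List.length_append, Finset.card_insert_of_notMem ht]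
      rw [Finset.card_empty] at hC
      omega
    · rw [act_append, hc, act_smul, hd, smul_smul]

theorem dotProduct_self_of_normalized {ψ : Bits n → ℂ} (hψ : ∑ x, ‖ψ x‖ ^ 2 = 1) :
    star ψ ⬝ᵥ ψ = 1 := by
  have : (∑ x, (‖ψ x‖ : ℂ) ^ 2) = 1 := by exact_mod_cast hψ
  rw [← this, dotProduct]
  exact Finset.sum_congr rfl fun x _ => Complex.conj_mul' (ψ x)

/-- A circuit that disentangles a state is inverted to a circuit that prepares it. -/
theorem exists_prepares_of_act_eq (hn : 0 < n) {ψ : Bits n → ℂ} (hψ : ∑ x, ‖ψ x‖ ^ 2 = 1)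
    {C : Circuit n} {z : Bits n} {c : ℂ} (hC : act C ψ = c • ket z) :
    ∃ D : Circuit n, Circuit.Prepares D ψ ∧ D.length ≤ C.length + n + 1 := by
  obtain ⟨X, hX, b, hb⟩ := exists_act_ket_eq_smul_ket_zero Finset.univ z (by simp)
  set a : ℂ := c * b with ha
  have hCX : act (C ++ X) ψ = a • ket 0 := by
    rw [act_append, hC, act_smul, hb, smul_smul]
  have haa : a * star a = 1 := by
    rw [← dotProduct_self_of_normalized hψ, ← star_act_dotProduct_act (C ++ X), hCX, star_smul,
      smul_dotProduct, star_ket_dotProduct]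
    simp [ket, mul_comm]
  -- Normalization makes `a` unimodular, so the scalar matrix `a` is a legitimate gate; it supplies
  -- the global phase and makes the preparation exact.
  let U : Matrix.unitaryGroup (Fin 2) ℂ := ⟨!![a, 0; 0, a],
    mem_unitaryGroup_two (by simpa using haa) (by simp) (by simpa using haa)⟩
  refine ⟨.single ⟨0, hn⟩ U :: inv (C ++ X), ?_, ?_⟩
  · have hU : (Gate.single ⟨0, hn⟩ U).toMatrix *ᵥ ket 0 = a • (ket 0 : Bits n → ℂ) := by
      ext x
      have hx : ∀ i b, x i = b → update x i b = x := by rintro i b rfl; simp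
      rw [single_mulVec, Fin.sum_univ_two]
      rcases fin_two_cases (x ⟨0, hn⟩) with h | h <;> simp [U, h, hx _ _ h]
    change act _ (ket 0) = ψ
    rw [act_cons, hU, ← hCX, act_inv_act]
  · simp only [List.length_cons, length_inv, List.length_append]
    rw [Finset.card_univ, Fintype.card_fin] at hX
    omega

end SparsePrep

/-! ### Choice of parameters -/

open SparsePrep in
theorem theorem1 :
    ∃ K : ℝ, 0 < K ∧ ∀ n : ℕ, 2 ≤ n → ∀ (d : ℕ) (ψ : SparsePrep.Bits n → ℂ),
      SparsePrep.IsSparseState d ψ →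
        ∃ C : SparsePrep.Circuit n, SparsePrep.Circuit.Prepares C ψ ∧
          (SparsePrep.Circuit.size C : ℝ) ≤ K * ((n : ℝ) * (d : ℝ) / Real.logb 2 (n : ℝ) + (n : ℝ)) := by
  refine ⟨500, by norm_num, fun n hn d ψ hψ => ?_⟩
  have hs : (supp ψ).card ≤ d := by
    have : (supp ψ : Set (Bits n)) = Function.support ψ := by ext x; simp
    rw [← Set.ncard_coe_finset, this]
    exact hψ.sparse
  -- Taking `h` as half of `log₂ n`, rounded down, leaves room for the factor `m` in `m * 2 ^ m`
  -- with `m = h + 2`, so a round stays linear in `n`, while `2 * h + 2` still dominates `log₂ n`.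
  obtain ⟨h, hh1, hh2⟩ : ∃ h, 2 ^ h * 2 ^ h ≤ n ∧ n < 2 ^ (2 * h + 2) := by
    refine ⟨Nat.log 2 n / 2, ?_, ?_⟩
    · rw [← pow_add]
      exact (Nat.pow_le_pow_right (by norm_num) (by omega)).trans
        (Nat.pow_log_le_self 2 (by omega))
    · exact (Nat.lt_pow_succ_log_self (by norm_num) n).trans_le
        (Nat.pow_le_pow_right (by norm_num) (by omega))
  have hpow : h + 1 ≤ 2 ^ h := Nat.lt_two_pow_self
  have hpow2 : 2 ^ h ≤ 2 ^ h * 2 ^ h := Nat.le_mul_of_pos_left _ (by positivity)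
  have hn1 : (1 : ℝ) < n := by exact_mod_cast hn
  have hlog : 0 < Real.logb 2 n := Real.logb_pos (by norm_num) hn1
  have hlog2 : Real.logb 2 n ≤ 2 * h + 2 := by
    have h1 : (n : ℝ) ≤ 2 ^ (2 * h + 2) := by exact_mod_cast hh2.le
    have h2 := Real.logb_le_logb_of_le (b := 2) (by norm_num) (by linarith) h1
    rw [Real.logb_pow, Real.logb_self_eq_one (by norm_num)] at h2
    push_cast at h2
    linarith
  set ℓ := Real.logb 2 (n : ℝ)
  obtain ⟨C, z, c, hC, hlen⟩ : ∃ (C : Circuit n) (z : Bits n) (c : ℂ), act C ψ = c • ket z ∧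
      (C.length : ℝ) ≤ 400 * (n * d / ℓ + n) := by
    by_cases hm : (supp ψ).card * (h + 1 + 1) + 2 ^ (h + 1 + 1) < 2 ^ n
    · obtain ⟨C, z, c, hC, hlen⟩ := exists_reduction_to_ket hn (by omega) ψ hm
      refine ⟨C, z, c, hC, ?_⟩
      have hB : 142 * n + (h + 1 + 1 + 12) * 2 ^ (h + 1 + 1) ≤ 200 * n := by
        have : (h + 1 + 1 + 12) * 2 ^ (h + 1 + 1) ≤ 56 * (2 ^ h * 2 ^ h) := by
          rw [pow_succ, pow_succ]
          nlinarith
        omega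
      have h1 : (h + 1) * C.length ≤ 200 * n * (d + (h + 1)) :=
        hlen.trans (Nat.mul_le_mul hB (by omega))
      have h2 : ((h : ℝ) + 1) * C.length ≤ 200 * n * (d + (h + 1)) := by exact_mod_cast h1
      have h3 : (C.length : ℝ) ≤ 200 * n * (d + (h + 1)) / (h + 1) := by
        rw [le_div_iff₀ (by positivity)]
        linarith
      have h4 : 200 * (n : ℝ) * (d + (h + 1)) / (h + 1) = 400 * (n * d / (2 * h + 2)) + 200 * n := by
        field_simp
        ring
      have h5 : (n : ℝ) * d / (2 * h + 2) ≤ n * d / ℓ :=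
        div_le_div_of_nonneg_left (by positivity) hlog hlog2
      linarith
    -- Here `2 ^ n ≤ d * (h + 2) + 4 * n`, and `h + 2` is at most `4 * n / log₂ n`, so the generic
    -- circuit of size `6 * 2 ^ n` is within the bound.
    · obtain ⟨C, hC, ⟨c, hc⟩, -⟩ := exists_disentangler Finset.univ ψ (by simp)
      refine ⟨C, 0, c, hc, ?_⟩
      rw [Finset.card_univ, Fintype.card_fin] at hC
      have h1 : C.length ≤ 6 * (d * (h + 2) + 4 * n) := by
        have h2 : (supp ψ).card * (h + 1 + 1) ≤ d * (h + 2) := Nat.mul_le_mul_right _ hs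
        rw [pow_succ, pow_succ] at hm
        omega
      have h2 : (C.length : ℝ) ≤ 6 * (d * (h + 2) + 4 * n) := by exact_mod_cast h1
      have h3 : (h + 2) * (2 * h + 2) ≤ 4 * n := by nlinarith
      have h4 : ((h : ℝ) + 2) * (2 * h + 2) ≤ 4 * n := by exact_mod_cast h3
      have h5 : (d : ℝ) * (h + 2) ≤ 4 * (n * d / ℓ) := by
        rw [mul_div_assoc', le_div_iff₀ hlog]
        calc (d : ℝ) * (h + 2) * ℓ ≤ d * (h + 2) * (2 * h + 2) := by gcongr
          _ = d * ((h + 2) * (2 * h + 2)) := by ring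
          _ ≤ d * (4 * n) := by gcongr
          _ = 4 * (n * d) := by ring
      have h6 : 0 ≤ (n : ℝ) * d / ℓ := by positivity
      linarith
  obtain ⟨D, hD, hD'⟩ := exists_prepares_of_act_eq (by omega) hψ.normalized hC
  refine ⟨D, hD, ?_⟩
  have h1 : (D.length : ℝ) ≤ C.length + n + 1 := by exact_mod_cast hD'
  have h2 : 0 ≤ (n : ℝ) * d / ℓ := by positivity
  rw [Circuit.size]
  linarith
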